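/- Let $G$ be a word hyperbolic group (that is, $G$ has some finite generating set for which the geodesic triangles in the Cayley graph are uniformly slim), and let $\mathcal{G}=\{g_1,\dots,g_k\}$ be a finite generating set of $G$, with $g_1,\dots,g_k$ distinct elements of $G$ and $\mathcal{G}$ closed under inversion. For a word $w=g_{i_1}\cdots g_{i_n}$ in the letters $\mathcal{G}$ let $\overline{w}\in G$ be its value; $w$ is called geodesic if no shorter word has the value $\overline{w}$. For $g\in G$ let $p_{\mathcal{G}}(g)$ be the number of geodesics from $1$ to $g$ in the Cayley graph of $G$ with respect to $\mathcal{G}$. Then there are a natural number $m$, integer $m\times m$ matrices $M_1,\dots,M_k$, a row vector $u=[u_1\ \dots\ u_m]$ and a column vector $v=[v_1\ \dots\ v_m]^{T}$ with integer entries such that for every $g\in G$ and every geodesic word $g_{i_1}\cdots g_{i_n}$ with value $g$, $$p_{\mathcal{G}}(g)=u\,M_{i_1}\cdots M_{i_n}\,v .$$ Moreover these can be chosen as the transition-count data of a synchronous two-tape automaton: there is a deterministic finite automaton $F$ with state set $\{1,\dots,m\}$, reading pairs $(a,a')$ in which each of $a,a'$ is an element of $\mathcal{G}$ or a blank, whose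 language is exactly the set of pairs $(w,w')$ of geodesic words with $\overline{w}=\overline{w'}$ (a pair of words is read letter by letter, the shorter one padded at its end with blanks), such that the $(s,t)$ entry of $M_i$ is the number of transitions of $F$ from state $s$ to state $t$ with a label of the form $(g_i,a')$, where $a'$ is an element of $\mathcal{G}$ or the blank; $u_s$ is $1$ if $s$ is the start state of $F$ and $0$ otherwise; and $v_s$ is $1$ if $s$ is an accept state of $F$ and $0$ otherwise. -/

import Mathlib

open scoped Matrix

/-! ### Geodesics and hyperbolicity in graphs -/

/-- A walk in a graph is geodesic if its length is the distance between its endpoints. -/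
def SimpleGraph.Walk.IsGeodesic {V : Type*} {Γ : SimpleGraph V} {x y : V}
    (p : Γ.Walk x y) : Prop :=
  p.length = Γ.dist x y

/-- A connected graph is (Gromov, or Rips) hyperbolic if, for some `δ`, every geodesic triangle
is `δ`-slim: each side lies in the `δ`-neighbourhood of the union of the other two sides.
Triangles are taken with vertices, and sides sampled, at the vertices of the graph; this changes
only the value of `δ` in comparison with the geometric realization. -/
def SimpleGraph.IsHyperbolic {V : Type*} (Γ : SimpleGraph V) : Prop :=
  Γ.Connected ∧ ∃ δ : ℕ, ∀ (x y z : V) (p : Γ.Walk x y) (q : Γ.Walk y z) (r : Γ.Walk x z),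
    p.IsGeodesic → q.IsGeodesic → r.IsGeodesic →
      ∀ a ∈ p.support, ∃ b, (b ∈ q.support ∨ b ∈ r.support) ∧ Γ.dist a b ≤ δ

/-- A group is word hyperbolic if it has a finite generating set whose Cayley graph is
hyperbolic. -/
def IsWordHyperbolic (G : Type*) [Group G] : Prop :=
  ∃ S : Finset G, Subgroup.closure (S : Set G) = ⊤ ∧
    (SimpleGraph.mulCayley (S : Set G)).IsHyperbolic

/-! ### Words, geodesic words and the Pascal function of a group with generators -/

namespace GeneratedGroup

/-- `gen` enumerates, without repetition, a generating set that is closed under inversion. -/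
structure IsGeneratingSet {G : Type*} [Group G] {k : ℕ} (gen : Fin k → G) : Prop where
  injective : Function.Injective gen
  inv_mem : ∀ i, (gen i)⁻¹ ∈ Set.range gen
  closure_eq_top : Subgroup.closure (Set.range gen) = ⊤

variable {G : Type*} [Group G] {k : ℕ} (gen : Fin k → G)

/-- The value in `G` of a word in the generators. -/
def value (w : List (Fin k)) : G := (w.map gen).prod

/-- The word length of `g`: the length of a shortest word with value `g`. -/
noncomputable def wordLength (g : G) : ℕ :=
  sInf {n | ∃ w : List (Fin k), value gen w = g ∧ w.length = n}

/-- A word is geodesic if it is a shortest word for its value. -/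
def IsGeodesicWord (w : List (Fin k)) : Prop :=
  w.length = wordLength gen (value gen w)

/-- The Pascal function: the number of geodesics from `1` to `g` in the Cayley graph. -/
noncomputable def pascal (g : G) : ℤ :=
  (Nat.card {p : (SimpleGraph.mulCayley (Set.range gen)).Walk 1 g // p.IsGeodesic} : ℤ)

end GeneratedGroup

/-! ### Synchronous two-tape automata -/

namespace TwoTape

/-- A letter read by a two-tape automaton; `none` is the blank. (The letter consisting of two blanks
never occurs in a padded pair of words.) -/
abbrev Letter (α : Type*) := Option α × Option α

/-- The pair of words `(w, w')` read letter by letter, the shorter word being padded at its end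
with blanks. -/
def pad {α : Type*} (w w' : List α) : List (Letter α) :=
  List.zipWithAll Prod.mk w w'

/-- The language over pairs of letters given by a relation between words. -/
def relLanguage {α : Type*} (R : List α → List α → Prop) : Language (Letter α) :=
  {x | ∃ w w', R w w' ∧ pad w w' = x}

variable {α σ : Type*} [Finite α] (F : DFA (Letter α) σ)

/-- The `(s, t)` entry is the number of transitions from `s` to `t` with a label of the form
`(a, a')`, where `a` is fixed and `a'` is any letter or the blank. -/
noncomputable def transitionMatrix (a : α) : Matrix σ σ ℤ :=
  Matrix.of fun s t => (Nat.card {a' : Option α // F.step s (some a, a') = t} : ℤ)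

/-- The row vector with entry `1` at the start state and `0` elsewhere. -/
def startVector [DecidableEq σ] : σ → ℤ := Pi.single F.start 1

/-- The column vector with entry `1` at the accept states and `0` elsewhere. -/
noncomputable def acceptVector : σ → ℤ := F.accept.indicator 1

end TwoTape

/-!
The pairs of geodesic words with equal values form a regular language. Once a deterministic
automaton for it is given, the entry of a product of its transition matrices counts the words on the
second tape that accompany a fixed word on the first, so for a geodesic word `w` the number
`u M_{i_1} ⋯ M_{i_n} v` is the number of geodesic words with the value of `w`
(`TwoTape.startVector_vecMul_dotProduct`, `GeneratedGroup.card_acceptedSecondTape`), and geodesic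
words correspond to geodesic walks in the Cayley graph
(`GeneratedGroup.IsGeneratingSet.pascal_eq_card`).

Regularity (`GeneratedGroup.isRegular_relLanguage_geodesicPair`) is shown by counting left
quotients. After reading a pair `(w, w')` of geodesic prefixes of equal length, what may follow
depends only on the word difference `w⁻¹ w'` and on the geodesic continuations of `w`. Geodesics
with a common origin and ends at distance at most one fellow-travel
(`GeneratedGroup.exists_fellowTravel`), so only finitely many word differences occur. By Cannon's
argument the geodesic continuations of `w` are determined by the elements of a fixed ball that
shorten the value of `w` (`GeneratedGroup.isGeodesicWord_append_of_shorteningSet_eq`), so there are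
finitely many possibilities for these as well.

The given generating set need not be the one whose Cayley graph is assumed hyperbolic. Its
geodesics are quasi-geodesics in that Cayley graph, and fellow travelling is deduced from the
stability of quasi-geodesics in hyperbolic graphs
(`SimpleGraph.HasSlimIntervals.exists_tracksGeodesics`,
`SimpleGraph.HasSlimIntervals.exists_dist_interval_le`). Slimness is used in the form: for `a` on a
geodesic from `x` to `y` and any `z`, some vertex near `a` lies on a geodesic from `x` to `z` or from
`z` to `y`. Together with repeated halving, this keeps geodesics within a distance logarithmic in
`n` of any path with `n` steps. If the geodesics are within `D` of a quasi-geodesic, then a piece of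
length `O(D)` of the quasi-geodesic controls each of their points, which improves `D` to
`O(log D)`; so a uniform bound holds.
-/

/-! ### Slim intervals and stability of quasi-geodesics -/

namespace SimpleGraph

variable {V : Type*} {Γ : SimpleGraph V}

/-- The metric interval between two vertices of a graph: the vertices that lie on some geodesic
between them. -/
def interval (Γ : SimpleGraph V) (x y : V) : Set V :=
  {a | Γ.dist x a + Γ.dist a y = Γ.dist x y}

/-- Slimness of triangles phrased with metric intervals in place of chosen geodesic sides. -/
def HasSlimIntervals (Γ : SimpleGraph V) (δ : ℕ) : Prop :=
  ∀ x y z a, a ∈ Γ.interval x y → ∃ b, (b ∈ Γ.interval x z ∨ b ∈ Γ.interval z y) ∧ Γ.dist a b ≤ δ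

lemma mem_interval {x y a : V} :
    a ∈ Γ.interval x y ↔ Γ.dist x a + Γ.dist a y = Γ.dist x y := Iff.rfl

lemma interval_comm (x y : V) : Γ.interval x y = Γ.interval y x := by
  ext a
  simp only [mem_interval, Γ.dist_comm (u := x), Γ.dist_comm (v := y)]
  rw [add_comm]

lemma right_mem_interval (x y : V) : y ∈ Γ.interval x y := by simp [mem_interval]

lemma Walk.IsGeodesic.mem_interval (hΓ : Γ.Connected) {x y a : V} {p : Γ.Walk x y}
    (hp : p.IsGeodesic) (ha : a ∈ p.support) : a ∈ Γ.interval x y := by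
  classical
  have h1 := congrArg Walk.length (p.take_spec ha)
  rw [Walk.length_append] at h1
  have h2 := Γ.dist_le (p.takeUntil a ha)
  have h3 := Γ.dist_le (p.dropUntil a ha)
  have h4 : Γ.dist x y ≤ Γ.dist x a + Γ.dist a y := hΓ.dist_triangle
  have h5 : p.length = Γ.dist x y := hp
  rw [SimpleGraph.mem_interval]
  omega

lemma exists_isGeodesic_of_mem_interval (hΓ : Γ.Connected) {x y a : V}
    (ha : a ∈ Γ.interval x y) : ∃ p : Γ.Walk x y, p.IsGeodesic ∧ a ∈ p.support := by
  obtain ⟨p, hp⟩ := hΓ.exists_walk_length_eq_dist x a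
  obtain ⟨q, hq⟩ := hΓ.exists_walk_length_eq_dist a y
  refine ⟨p.append q, ?_, ?_⟩
  · rw [Walk.IsGeodesic, Walk.length_append, hp, hq]
    exact ha
  · rw [Walk.mem_support_append_iff]
    exact Or.inl p.end_mem_support

lemma IsHyperbolic.exists_hasSlimIntervals (h : Γ.IsHyperbolic) :
    ∃ δ, Γ.HasSlimIntervals δ := by
  obtain ⟨hΓ, δ, hδ⟩ := h
  refine ⟨δ, fun x y z a ha => ?_⟩
  obtain ⟨p, hp, hap⟩ := exists_isGeodesic_of_mem_interval hΓ ha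
  obtain ⟨q, hq⟩ := hΓ.exists_walk_length_eq_dist y z
  obtain ⟨r, hr⟩ := hΓ.exists_walk_length_eq_dist x z
  obtain ⟨b, hb, hab⟩ := hδ x y z p q r hp hq hr a hap
  refine ⟨b, ?_, hab⟩
  rcases hb with hb | hb
  · right
    rw [interval_comm]
    exact Walk.IsGeodesic.mem_interval hΓ hq hb
  · exact Or.inl (Walk.IsGeodesic.mem_interval hΓ hr hb)

lemma HasSlimIntervals.mono {δ δ' : ℕ} (h : Γ.HasSlimIntervals δ) (hδ : δ ≤ δ') :
    Γ.HasSlimIntervals δ' := fun x y z a ha => by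
  obtain ⟨b, hb, hab⟩ := h x y z a ha
  exact ⟨b, hb, hab.trans hδ⟩

lemma exists_mem_interval_dist_eq (hΓ : Γ.Connected) {x y : V} {i : ℕ} (hi : i ≤ Γ.dist x y) :
    ∃ a ∈ Γ.interval x y, Γ.dist x a = i := by
  obtain ⟨p, hp⟩ := hΓ.exists_walk_length_eq_dist x y
  have h1 := Γ.dist_le (p.take i)
  have h2 := Γ.dist_le (p.drop i)
  have h3 : Γ.dist x y ≤ Γ.dist x (p.getVert i) + Γ.dist (p.getVert i) y := hΓ.dist_triangle
  rw [Walk.take_length] at h1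
  rw [Walk.drop_length] at h2
  refine ⟨p.getVert i, ?_, ?_⟩
  · rw [mem_interval]; omega
  · omega

lemma mem_interval_of_mem_of_mem (hΓ : Γ.Connected) {x y a b : V} (ha : a ∈ Γ.interval x y)
    (hb : b ∈ Γ.interval a x) : b ∈ Γ.interval x y := by
  rw [mem_interval] at *
  have h1 : Γ.dist b y ≤ Γ.dist b a + Γ.dist a y := hΓ.dist_triangle
  have h2 : Γ.dist x y ≤ Γ.dist x b + Γ.dist b y := hΓ.dist_triangle
  rw [Γ.dist_comm (u := x) (v := a)] at ha
  rw [Γ.dist_comm (u := x) (v := b)] at *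
  rw [Γ.dist_comm (u := a) (v := b)] at *
  omega

/-- Two points of an interval on opposite sides of a third point have that point between them. -/
lemma mem_interval_of_between (hΓ : Γ.Connected) {x y a b c : V} (ha : a ∈ Γ.interval x y)
    (hb : b ∈ Γ.interval a x) (hc : c ∈ Γ.interval a y) : a ∈ Γ.interval b c := by
  rw [mem_interval] at *
  have h1 : Γ.dist x y ≤ Γ.dist x b + Γ.dist b y := hΓ.dist_triangle
  have h2 : Γ.dist b y ≤ Γ.dist b c + Γ.dist c y := hΓ.dist_triangle
  have h3 : Γ.dist b c ≤ Γ.dist b a + Γ.dist a c := hΓ.dist_triangle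
  have h4 := Γ.dist_comm (u := x) (v := a)
  have h5 := Γ.dist_comm (u := x) (v := b)
  have h6 := Γ.dist_comm (u := a) (v := b)
  omega

/-- A path with `n ≤ 2 ^ N` steps stays logarithmically close to the geodesics between its
endpoints: halving the path `N` times costs `δ` at each subdivision. -/
lemma HasSlimIntervals.exists_dist_le_of_le_two_pow (hΓ : Γ.Connected) {δ : ℕ}
    (h : Γ.HasSlimIntervals δ) {L : ℕ} {f : ℕ → V} (N : ℕ) :
    ∀ (i n : ℕ), n ≤ 2 ^ N → (∀ k, i ≤ k → k < i + n → Γ.dist (f k) (f (k + 1)) ≤ L) →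
      ∀ a ∈ Γ.interval (f i) (f (i + n)),
        ∃ j, i ≤ j ∧ j ≤ i + n ∧ Γ.dist a (f j) ≤ δ * N + L := by
  induction N with
  | zero =>
    intro i n hn hf a ha
    refine ⟨i, le_rfl, by omega, ?_⟩
    have h1 : Γ.dist (f i) (f (i + n)) ≤ L := by
      obtain rfl | rfl : n = 0 ∨ n = 1 := by simp at hn; omega
      · simp
      · exact hf i le_rfl (by omega)
    rw [mem_interval] at ha
    rw [Γ.dist_comm]
    omega
  | succ N ih =>
    intro i n hn hf a ha
    have hn' : n ≤ 2 ^ N + 2 ^ N := by rw [pow_succ] at hn; omega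
    obtain ⟨b, hb, hab⟩ := h _ _ (f (i + n / 2)) a ha
    have key : ∃ j, i ≤ j ∧ j ≤ i + n ∧ Γ.dist b (f j) ≤ δ * N + L := by
      rcases hb with hb | hb
      · obtain ⟨j, h1, h2, h3⟩ := ih i (n / 2) (by omega)
          (fun k hk hk' => hf k hk (by omega)) b hb
        exact ⟨j, h1, by omega, h3⟩
      · have e : i + n = (i + n / 2) + (n - n / 2) := by omega
        rw [e] at hb
        obtain ⟨j, h1, h2, h3⟩ := ih (i + n / 2) (n - n / 2) (by omega)
          (fun k hk hk' => hf k (by omega) (by omega)) b hb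
        exact ⟨j, by omega, by omega, h3⟩
    obtain ⟨j, h1, h2, h3⟩ := key
    refine ⟨j, h1, h2, ?_⟩
    have h4 : Γ.dist a (f j) ≤ Γ.dist a b + Γ.dist b (f j) := hΓ.dist_triangle
    rw [mul_add, mul_one]
    omega

/-- `f 0, …, f n` is a discrete quasi-geodesic with constant `L`. The lower bound
`(j - i) / L ≤ dist (f i) (f j)` is stated without division or truncated subtraction. -/
structure IsQuasiGeodesic (Γ : SimpleGraph V) (L : ℕ) (f : ℕ → V) (n : ℕ) : Prop where
  dist_le : ∀ i j, i ≤ j → j ≤ n → Γ.dist (f i) (f j) ≤ L * (j - i)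
  le_dist : ∀ i j, i ≤ j → j ≤ n → j ≤ i + L * Γ.dist (f i) (f j)

/-- Every geodesic between the endpoints of `f 0, …, f n` stays within distance `D` of it. -/
def TracksGeodesics (Γ : SimpleGraph V) (f : ℕ → V) (n D : ℕ) : Prop :=
  ∀ a ∈ Γ.interval (f 0) (f n), ∃ k ≤ n, Γ.dist a (f k) ≤ D

/-- On a geodesic, from `a` towards the endpoint `e`, there is a point `y` at distance `2 * D` from
`a`, or `y = e` if `e` is closer. In the first case the geodesics that join `y` to a nearest point
`f i` stay away from `a`; in the second case `y` itself lies on `f`. -/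
lemma exists_far_or_endpoint (hΓ : Γ.Connected) {f : ℕ → V} {n D δ : ℕ}
    (hD : Γ.TracksGeodesics f n D) (hδ : 2 * δ < D) {a e : V}
    (hsub : ∀ y ∈ Γ.interval a e, y ∈ Γ.interval (f 0) (f n)) (he : ∃ k ≤ n, e = f k) :
    ∃ y ∈ Γ.interval a e, ∃ i ≤ n, Γ.dist y (f i) ≤ D ∧ Γ.dist a y ≤ 2 * D ∧
      ∀ b ∈ Γ.interval y (f i), Γ.dist a b ≤ 2 * δ → ∃ k ≤ n, Γ.dist a (f k) ≤ 2 * δ := by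
  by_cases hc : 2 * D ≤ Γ.dist a e
  · obtain ⟨y, hy, hay⟩ := exists_mem_interval_dist_eq hΓ hc
    obtain ⟨i, hi, hyi⟩ := hD y (hsub y hy)
    refine ⟨y, hy, i, hi, hyi, hay.le, fun b hb hab => ?_⟩
    -- such a `b` would be within `2 * δ < D` of `a` and within `D` of `y`
    exfalso
    rw [mem_interval] at hb
    have h1 : Γ.dist a y ≤ Γ.dist a b + Γ.dist b y := hΓ.dist_triangle
    rw [Γ.dist_comm (u := b)] at h1
    omega
  · obtain ⟨k, hk, rfl⟩ := he
    refine ⟨f k, right_mem_interval _ _, k, hk, by simp, by omega, fun b hb hab => ?_⟩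
    have h0 : Γ.dist (f k) b = 0 := by
      rw [mem_interval, dist_self] at hb; omega
    have : f k = b := hΓ.dist_eq_zero_iff.mp h0
    exact ⟨k, hk, this ▸ hab⟩

/-- The improvement step in the stability of quasi-geodesics: around a point `a` of a geodesic, cut
out a piece of the geodesic of length at most `4 * D` and compare it with the piece of `f`, of at
most `6 * L * D` steps, that runs alongside. -/
lemma TracksGeodesics.improve (hΓ : Γ.Connected) {δ L : ℕ} (h : Γ.HasSlimIntervals δ)
    {f : ℕ → V} {n D N : ℕ} (hf : Γ.IsQuasiGeodesic L f n) (hD : Γ.TracksGeodesics f n D)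
    (hδ : 2 * δ < D) (hN : 6 * L * D ≤ 2 ^ N) : Γ.TracksGeodesics f n (2 * δ + (δ * N + L)) := by
  intro a ha
  have ha' := ha
  rw [interval_comm] at ha'
  obtain ⟨y, hy, i, hi, hyi, hay, hyb⟩ := exists_far_or_endpoint hΓ hD hδ
    (fun y hy => mem_interval_of_mem_of_mem hΓ ha hy) ⟨0, by omega, rfl⟩
  obtain ⟨z, hz, j, hj, hzj, haz, hzb⟩ := exists_far_or_endpoint hΓ hD hδ
    (fun y hy => by
      rw [interval_comm]; exact mem_interval_of_mem_of_mem hΓ ha' hy) ⟨n, le_rfl, rfl⟩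
  have hyz := mem_interval_of_between hΓ ha hy hz
  have hij : Γ.dist (f i) (f j) ≤ 6 * D := by
    have h1 : Γ.dist (f i) (f j) ≤ Γ.dist (f i) y + Γ.dist y (f j) := hΓ.dist_triangle
    have h2 : Γ.dist y (f j) ≤ Γ.dist y a + Γ.dist a (f j) := hΓ.dist_triangle
    have h3 : Γ.dist a (f j) ≤ Γ.dist a z + Γ.dist z (f j) := hΓ.dist_triangle
    rw [Γ.dist_comm (v := y)] at h1
    rw [Γ.dist_comm (u := y) (v := a)] at h2
    omega
  -- the geodesics between two points of `f` that are few steps apart stay close to `f`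
  have mid : ∀ i j, i ≤ j → j ≤ n → Γ.dist (f i) (f j) ≤ 6 * D →
      ∀ b ∈ Γ.interval (f i) (f j), ∃ k ≤ n, Γ.dist b (f k) ≤ δ * N + L := by
    intro i j hij hj hd b hb
    have h1 := hf.le_dist i j hij hj
    have h2 : L * Γ.dist (f i) (f j) ≤ 6 * L * D := by
      calc _ ≤ L * (6 * D) := Nat.mul_le_mul_left _ hd
        _ = _ := by ring
    obtain ⟨m, rfl⟩ := Nat.exists_eq_add_of_le hij
    obtain ⟨k, -, hk, hbk⟩ := h.exists_dist_le_of_le_two_pow hΓ (L := L) (f := f) N i m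
      (by omega) (fun k _ hk' => by simpa using hf.dist_le k (k + 1) (by omega) (by omega)) b hb
    exact ⟨k, by omega, hbk⟩
  have fin : ∀ b, Γ.dist a b ≤ 2 * δ → (∃ k ≤ n, Γ.dist b (f k) ≤ δ * N + L) →
      ∃ k ≤ n, Γ.dist a (f k) ≤ 2 * δ + (δ * N + L) := by
    rintro b hab ⟨k, hk, hbk⟩
    have h1 : Γ.dist a (f k) ≤ Γ.dist a b + Γ.dist b (f k) := hΓ.dist_triangle
    exact ⟨k, hk, by omega⟩
  have weaken : (∃ k ≤ n, Γ.dist a (f k) ≤ 2 * δ) →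
      ∃ k ≤ n, Γ.dist a (f k) ≤ 2 * δ + (δ * N + L) := by
    rintro ⟨k, hk, hak⟩
    exact ⟨k, hk, by omega⟩
  obtain ⟨b, hb, hab⟩ := h y z (f i) a hyz
  rcases hb with hb | hb
  · exact weaken (hyb b hb (by omega))
  obtain ⟨c, hc, hbc⟩ := h (f i) z (f j) b hb
  have hac : Γ.dist a c ≤ 2 * δ := by
    have h1 : Γ.dist a c ≤ Γ.dist a b + Γ.dist b c := hΓ.dist_triangle
    omega
  rcases hc with hc | hc
  · refine fin c hac ?_
    rcases le_total i j with hle | hle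
    · exact mid i j hle hj hij c hc
    · rw [interval_comm] at hc
      rw [Γ.dist_comm] at hij
      exact mid j i hle hi hij c hc
  · rw [interval_comm] at hc
    exact weaken (hzb c hc hac)

lemma exists_forall_linear_le_two_pow (A B : ℕ) : ∃ N₀, ∀ N ≥ N₀, A + B * N ≤ 2 ^ N := by
  have h : Filter.Tendsto (fun n : ℕ => (n : ℝ) ^ 1 / 2 ^ n) Filter.atTop (nhds 0) :=
    tendsto_pow_const_div_const_pow_of_one_lt 1 (by norm_num)
  have h1 := h.eventually (gt_mem_nhds (show (0 : ℝ) < 1 / (A + B + 1) by positivity))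
  obtain ⟨N₀, hN₀⟩ := Filter.eventually_atTop.mp h1
  refine ⟨N₀ + 1, fun N hN => ?_⟩
  have h2 := hN₀ N (by omega)
  rw [div_lt_div_iff₀ (by positivity) (by positivity)] at h2
  have h3 : N * (A + B + 1) < 2 ^ N := by
    have : ((N * (A + B + 1) : ℕ) : ℝ) < ((2 ^ N : ℕ) : ℝ) := by push_cast; linarith
    exact_mod_cast this
  nlinarith

/-- Half of the stability of quasi-geodesics (Morse lemma): geodesics stay close to
quasi-geodesics with the same endpoints. -/
lemma HasSlimIntervals.exists_tracksGeodesics (hΓ : Γ.Connected) {δ : ℕ}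
    (h : Γ.HasSlimIntervals δ) (L : ℕ) :
    ∃ R, ∀ (f : ℕ → V) (n : ℕ), Γ.IsQuasiGeodesic L f n → Γ.TracksGeodesics f n R := by
  -- enlarging the constants makes the bounds `B N` below unbounded in `N`
  have h' : Γ.HasSlimIntervals (δ + 1) := h.mono (by omega)
  set ε := δ + 1 with hε
  set K := L + 1 with hK
  let B : ℕ → ℕ := fun N => 2 * ε + (ε * N + K)
  obtain ⟨N₀, hN₀⟩ := exists_forall_linear_le_two_pow (6 * K * (3 * ε + K)) (6 * K * ε)
  refine ⟨B N₀, fun f n hf => ?_⟩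
  have hf' : Γ.IsQuasiGeodesic K f n :=
    ⟨fun i j hij hj => (hf.dist_le i j hij hj).trans (Nat.mul_le_mul_right _ (by omega)),
      fun i j hij hj => (hf.le_dist i j hij hj).trans
        (Nat.add_le_add_left (Nat.mul_le_mul_right _ (by omega)) _)⟩
  have step : ∀ N ≥ N₀, Γ.TracksGeodesics f n (B (N + 1)) → Γ.TracksGeodesics f n (B N) := by
    intro N hN hB
    refine hB.improve hΓ h' hf' ?_ ?_
    · simp only [B]; omega
    · calc _ = 6 * K * (3 * ε + K) + 6 * K * ε * N := by simp only [B]; ring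
        _ ≤ _ := hN₀ N hN
  have down : ∀ m, Γ.TracksGeodesics f n (B (N₀ + m)) → Γ.TracksGeodesics f n (B N₀) := by
    intro m
    induction m with
    | zero => exact id
    | succ m ih => exact fun hm => ih (step _ (by omega) hm)
  refine down (Γ.dist (f 0) (f n)) fun a ha => ⟨0, by omega, ?_⟩
  rw [mem_interval] at ha
  rw [Γ.dist_comm]
  have : N₀ + Γ.dist (f 0) (f n) ≤ ε * (N₀ + Γ.dist (f 0) (f n)) :=
    Nat.le_mul_of_pos_left _ (by omega)
  simp only [B]
  omega

/-- The other half of the stability of quasi-geodesics: quasi-geodesics stay close to geodesics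
with the same endpoints. -/
lemma HasSlimIntervals.exists_dist_interval_le (hΓ : Γ.Connected) {δ : ℕ}
    (h : Γ.HasSlimIntervals δ) (L : ℕ) :
    ∃ R, ∀ (f : ℕ → V) (n : ℕ), Γ.IsQuasiGeodesic L f n →
      ∀ i ≤ n, ∃ a ∈ Γ.interval (f 0) (f n), Γ.dist (f i) a ≤ R := by
  obtain ⟨R, hR⟩ := h.exists_tracksGeodesics hΓ L
  refine ⟨L * (L * (2 * R + 1)) + R, fun f n hf i hi => ?_⟩
  obtain ⟨p, hp⟩ := hΓ.exists_walk_length_eq_dist (f 0) (f n)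
  have hmem : ∀ s, p.getVert s ∈ Γ.interval (f 0) (f n) := fun s =>
    Walk.IsGeodesic.mem_interval hΓ hp (p.getVert_mem_support s)
  -- a point of the geodesic close to points of `f` both before and after `f i` is close to `f i`
  have close : ∀ s k k', k ≤ i → i ≤ k' → k' ≤ n → Γ.dist (p.getVert s) (f k) ≤ R →
      Γ.dist (p.getVert s) (f k') ≤ R + 1 →
      ∃ a ∈ Γ.interval (f 0) (f n), Γ.dist (f i) a ≤ L * (L * (2 * R + 1)) + R := by
    intro s k k' hk hk' hn h1 h2
    refine ⟨p.getVert s, hmem s, ?_⟩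
    have h3 : Γ.dist (f k) (f k') ≤ Γ.dist (f k) (p.getVert s) + Γ.dist (p.getVert s) (f k') :=
      hΓ.dist_triangle
    have h4 := hf.le_dist k k' (by omega) hn
    have h5 := hf.dist_le k i hk hi
    have h6 : Γ.dist (f i) (p.getVert s) ≤ Γ.dist (f i) (f k) + Γ.dist (f k) (p.getVert s) :=
      hΓ.dist_triangle
    rw [Γ.dist_comm (u := f k) (v := p.getVert s)] at h3 h6
    rw [Γ.dist_comm (u := f i) (v := f k)] at h6
    have h7 : L * Γ.dist (f k) (f k') ≤ L * (2 * R + 1) := Nat.mul_le_mul_left _ (by omega)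
    have h8 : L * (i - k) ≤ L * (L * (2 * R + 1)) := Nat.mul_le_mul_left _ (by omega)
    omega
  -- moving along the geodesic, the nearby points of `f` pass from one side of `f i` to the other
  have walk : ∀ s, (∃ k ≤ i, Γ.dist (p.getVert s) (f k) ≤ R) ∨
      ∃ a ∈ Γ.interval (f 0) (f n), Γ.dist (f i) a ≤ L * (L * (2 * R + 1)) + R := by
    intro s
    induction s with
    | zero => exact Or.inl ⟨0, by omega, by simp⟩
    | succ s ih =>
      rcases ih with ⟨k, hk, hks⟩ | ih
      · obtain ⟨k', hk'n, hk'⟩ := hR f n hf _ (hmem (s + 1))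
        by_cases hle : k' ≤ i
        · exact Or.inl ⟨k', hle, hk'⟩
        · refine Or.inr (close s k k' hk (by omega) hk'n hks ?_)
          have h1 : Γ.dist (p.getVert s) (p.getVert (s + 1)) ≤ 1 := by
            by_cases hs : s < p.length
            · exact (dist_eq_one_iff_adj.mpr (p.adj_getVert_succ hs)).le
            · rw [p.getVert_of_length_le (by omega), p.getVert_of_length_le (by omega)]
              simp
          have h2 : Γ.dist (p.getVert s) (f k') ≤
            Γ.dist (p.getVert s) (p.getVert (s + 1)) + Γ.dist (p.getVert (s + 1)) (f k') :=
              hΓ.dist_triangle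
          omega
      · exact Or.inr ih
  rcases walk p.length with ⟨k, hk, hks⟩ | hdone
  · refine close p.length k n hk hi le_rfl hks ?_
    simp
  · exact hdone

end SimpleGraph

/-! ### The word metric -/

namespace GeneratedGroup

variable {G : Type*} [Group G] {k : ℕ} {gen : Fin k → G}

@[simp] lemma value_nil : value gen [] = 1 := rfl

@[simp] lemma value_cons (a : Fin k) (w : List (Fin k)) :
    value gen (a :: w) = gen a * value gen w := by simp [value]

@[simp] lemma value_append (w w' : List (Fin k)) :
    value gen (w ++ w') = value gen w * value gen w' := by simp [value]

lemma wordLength_value_le (w : List (Fin k)) : wordLength gen (value gen w) ≤ w.length :=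
  Nat.sInf_le ⟨w, rfl, rfl⟩

lemma wordLength_one : wordLength gen 1 = 0 :=
  Nat.le_zero.mp (wordLength_value_le (gen := gen) [])

namespace IsGeneratingSet

lemma exists_value_inv (hgen : IsGeneratingSet gen) (w : List (Fin k)) :
    ∃ w', value gen w' = (value gen w)⁻¹ ∧ w'.length = w.length := by
  induction w with
  | nil => exact ⟨[], by simp⟩
  | cons a w ih =>
    obtain ⟨w', hw', hl⟩ := ih
    obtain ⟨b, hb⟩ := hgen.inv_mem a
    exact ⟨w' ++ [b], by simp [hw', hb], by simp [hl]⟩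

lemma exists_value_eq (hgen : IsGeneratingSet gen) (g : G) : ∃ w, value gen w = g := by
  have hg : g ∈ Subgroup.closure (Set.range gen) := by
    rw [hgen.closure_eq_top]; trivial
  induction hg using Subgroup.closure_induction with
  | mem x hx =>
    obtain ⟨i, rfl⟩ := hx
    exact ⟨[i], by simp⟩
  | one => exact ⟨[], rfl⟩
  | mul x y _ _ hx hy =>
    obtain ⟨w, rfl⟩ := hx
    obtain ⟨w', rfl⟩ := hy
    exact ⟨w ++ w', by simp⟩
  | inv x _ hx =>
    obtain ⟨w, rfl⟩ := hx
    obtain ⟨w', hw', -⟩ := hgen.exists_value_inv w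
    exact ⟨w', hw'⟩

lemma exists_isGeodesicWord (hgen : IsGeneratingSet gen) (g : G) :
    ∃ w, value gen w = g ∧ IsGeodesicWord gen w := by
  obtain ⟨w, hw⟩ := hgen.exists_value_eq g
  obtain ⟨w', rfl, h⟩ := Nat.sInf_mem (s := {n | ∃ w, value gen w = g ∧ w.length = n})
    ⟨_, w, hw, rfl⟩
  exact ⟨w', rfl, h⟩

lemma wordLength_mul_le (hgen : IsGeneratingSet gen) (g h : G) :
    wordLength gen (g * h) ≤ wordLength gen g + wordLength gen h := by
  obtain ⟨w, rfl, hw⟩ := hgen.exists_isGeodesicWord g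
  obtain ⟨w', rfl, hw'⟩ := hgen.exists_isGeodesicWord h
  have := wordLength_value_le (gen := gen) (w ++ w')
  rw [← hw, ← hw']
  simpa using this

lemma wordLength_inv (hgen : IsGeneratingSet gen) (g : G) :
    wordLength gen g⁻¹ = wordLength gen g := by
  have key : ∀ g, wordLength gen g⁻¹ ≤ wordLength gen g := by
    intro g
    obtain ⟨w, rfl, hw⟩ := hgen.exists_isGeodesicWord g
    obtain ⟨w', hw', hl⟩ := hgen.exists_value_inv w
    rw [← hw', ← hw, ← hl]
    exact wordLength_value_le w'
  exact (key g).antisymm (by simpa using key g⁻¹)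

lemma wordLength_inv_mul_comm (hgen : IsGeneratingSet gen) (g h : G) :
    wordLength gen (g⁻¹ * h) = wordLength gen (h⁻¹ * g) := by
  rw [← hgen.wordLength_inv]; simp

/-- The triangle inequality for the left-invariant word metric. -/
lemma wordLength_inv_mul_le (hgen : IsGeneratingSet gen) (g h x : G) :
    wordLength gen (g⁻¹ * x) ≤ wordLength gen (g⁻¹ * h) + wordLength gen (h⁻¹ * x) := by
  have := hgen.wordLength_mul_le (g⁻¹ * h) (h⁻¹ * x)
  simpa [mul_assoc] using this

lemma finite_setOf_wordLength_le (hgen : IsGeneratingSet gen) (n : ℕ) :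
    {g | wordLength gen g ≤ n}.Finite := by
  refine ((List.finite_length_le (Fin k) n).image (value gen)).subset fun g hg => ?_
  obtain ⟨w, rfl, hw⟩ := hgen.exists_isGeodesicWord g
  exact ⟨w, le_of_eq_of_le hw hg, rfl⟩

end IsGeneratingSet

lemma isGeodesicWord_append (hgen : IsGeneratingSet gen) {w w' : List (Fin k)}
    (h : IsGeodesicWord gen (w ++ w')) : IsGeodesicWord gen w ∧ IsGeodesicWord gen w' := by
  have h1 := hgen.wordLength_mul_le (value gen w) (value gen w')
  have h2 := wordLength_value_le (gen := gen) w
  have h3 := wordLength_value_le (gen := gen) w'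
  rw [IsGeodesicWord, value_append, List.length_append] at h
  constructor <;> rw [IsGeodesicWord] <;> omega

lemma value_take_inv_mul_value_take (w : List (Fin k)) {i j : ℕ} (hij : i ≤ j) :
    (value gen (w.take i))⁻¹ * value gen (w.take j) = value gen ((w.take j).drop i) := by
  rw [inv_mul_eq_iff_eq_mul, ← value_append]
  congr 1
  conv_lhs => rw [← List.take_append_drop i (w.take j)]
  rw [List.take_take, min_eq_left hij]

lemma IsGeodesicWord.wordLength_take (hgen : IsGeneratingSet gen) {w : List (Fin k)}
    (hw : IsGeodesicWord gen w) {i j : ℕ} (hij : i ≤ j) (hj : j ≤ w.length) :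
    wordLength gen ((value gen (w.take i))⁻¹ * value gen (w.take j)) = j - i := by
  rw [value_take_inv_mul_value_take w hij]
  rw [← List.take_append_drop j w] at hw
  have h1 := (isGeodesicWord_append hgen hw).1
  rw [← List.take_append_drop i (w.take j)] at h1
  rw [← (isGeodesicWord_append hgen h1).2]
  simp [hj]

lemma wordLength_value_take_le (hgen : IsGeneratingSet gen) (w : List (Fin k)) (i j : ℕ) :
    wordLength gen ((value gen (w.take i))⁻¹ * value gen (w.take j)) ≤ (j - i) + (i - j) := by
  rcases le_total i j with hij | hij
  · rw [value_take_inv_mul_value_take w hij]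
    refine (wordLength_value_le _).trans ?_
    simp; omega
  · rw [hgen.wordLength_inv_mul_comm, value_take_inv_mul_value_take w hij]
    refine (wordLength_value_le _).trans ?_
    simp; omega

/-! ### Comparison with another Cayley graph and fellow travelling -/

lemma dist_mulCayley_mul_left {S : Set G} (hS : (SimpleGraph.mulCayley S).Connected) (c g h : G) :
    (SimpleGraph.mulCayley S).dist (c * g) (c * h) = (SimpleGraph.mulCayley S).dist g h := by
  have key : ∀ c g h : G,
      (SimpleGraph.mulCayley S).dist (c * g) (c * h) ≤ (SimpleGraph.mulCayley S).dist g h := by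
    intro c g h
    obtain ⟨p, hp⟩ := hS.exists_walk_length_eq_dist g h
    let φ : SimpleGraph.mulCayley S →g SimpleGraph.mulCayley S :=
      ⟨fun x => c * x, fun hxy => SimpleGraph.mulCayley_adj_mul_iff_right.mpr hxy⟩
    rw [← hp, ← SimpleGraph.Walk.length_map φ p]
    exact SimpleGraph.dist_le _
  exact (key c g h).antisymm (by simpa using key c⁻¹ (c * g) (c * h))

lemma exists_dist_mulCayley_le (hgen : IsGeneratingSet gen) {S : Set G}
    (hS : (SimpleGraph.mulCayley S).Connected) :
    ∃ L, ∀ g h, (SimpleGraph.mulCayley S).dist g h ≤ L * wordLength gen (g⁻¹ * h) := by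
  refine ⟨∑ i, (SimpleGraph.mulCayley S).dist 1 (gen i), fun g h => ?_⟩
  set L := ∑ i, (SimpleGraph.mulCayley S).dist 1 (gen i)
  have key : ∀ w : List (Fin k),
      (SimpleGraph.mulCayley S).dist 1 (value gen w) ≤ L * w.length := by
    intro w
    induction w with
    | nil => simp
    | cons a w ih =>
      have h1 : (SimpleGraph.mulCayley S).dist 1 (value gen (a :: w)) ≤
        (SimpleGraph.mulCayley S).dist 1 (gen a) +
          (SimpleGraph.mulCayley S).dist (gen a) (value gen (a :: w)) := hS.dist_triangle
      have h2 := dist_mulCayley_mul_left hS (gen a) 1 (value gen w)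
      rw [mul_one, ← value_cons] at h2
      have h3 : (SimpleGraph.mulCayley S).dist 1 (gen a) ≤ L :=
        Finset.single_le_sum (f := fun i => (SimpleGraph.mulCayley S).dist 1 (gen i))
          (fun _ _ => Nat.zero_le _) (Finset.mem_univ a)
      rw [List.length_cons, mul_add, mul_one]
      omega
  obtain ⟨w, hw, hl⟩ := hgen.exists_isGeodesicWord (g⁻¹ * h)
  have h1 := key w
  rw [hl, hw, ← dist_mulCayley_mul_left hS g] at h1
  simpa using h1

lemma exists_wordLength_le_dist_mulCayley (hgen : IsGeneratingSet gen) {S : Finset G}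
    (hS : (SimpleGraph.mulCayley (S : Set G)).Connected) :
    ∃ L, ∀ g h, wordLength gen (g⁻¹ * h) ≤ L * (SimpleGraph.mulCayley (S : Set G)).dist g h := by
  refine ⟨∑ s ∈ S, wordLength gen s, fun g h => ?_⟩
  obtain ⟨p, hp⟩ := hS.exists_walk_length_eq_dist g h
  rw [← hp]
  clear hp
  induction p with
  | nil => simp [wordLength_one]
  | @cons u v w huv p ih =>
    have h1 := hgen.wordLength_inv_mul_le u v w
    have h2 : wordLength gen (u⁻¹ * v) ≤ ∑ s ∈ S, wordLength gen s := by
      obtain ⟨-, h | h⟩ := (SimpleGraph.mulCayley_adj _ _ _).mp huv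
      · exact Finset.single_le_sum (f := wordLength gen) (fun _ _ => Nat.zero_le _) h
      · rw [hgen.wordLength_inv_mul_comm]
        exact Finset.single_le_sum (f := wordLength gen) (fun _ _ => Nat.zero_le _) h
    rw [SimpleGraph.Walk.length_cons, mul_add, mul_one]
    omega

/-- Geodesic words for an arbitrary finite generating set are quasi-geodesics in the given
hyperbolic Cayley graph, so two of them that start at `1` and end at distance at most one travel
together. -/
theorem exists_fellowTravel (hG : IsWordHyperbolic G) (hgen : IsGeneratingSet gen) :
    ∃ K, ∀ w w' : List (Fin k), IsGeodesicWord gen w → IsGeodesicWord gen w' →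
      wordLength gen ((value gen w)⁻¹ * value gen w') ≤ 1 → ∀ i ≤ w.length,
        wordLength gen ((value gen (w.take i))⁻¹ * value gen (w'.take i)) ≤ K := by
  obtain ⟨S, -, hS⟩ := hG
  obtain ⟨δ, hδ⟩ := hS.exists_hasSlimIntervals
  have hΓ := hS.1
  set Γ := SimpleGraph.mulCayley (S : Set G)
  obtain ⟨L₁, hL₁⟩ : ∃ L, ∀ g h, Γ.dist g h ≤ L * wordLength gen (g⁻¹ * h) :=
    exists_dist_mulCayley_le hgen hΓ
  obtain ⟨L₂, hL₂⟩ : ∃ L, ∀ g h, wordLength gen (g⁻¹ * h) ≤ L * Γ.dist g h :=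
    exists_wordLength_le_dist_mulCayley hgen hΓ
  have quasi : ∀ w : List (Fin k), IsGeodesicWord gen w →
      Γ.IsQuasiGeodesic (L₁ + L₂) (fun i => value gen (w.take i)) w.length := by
    intro w hw
    constructor
    · intro i j hij hj
      have h1 := hL₁ (value gen (w.take i)) (value gen (w.take j))
      rw [hw.wordLength_take hgen hij hj] at h1
      exact h1.trans (Nat.mul_le_mul_right _ (by omega))
    · intro i j hij hj
      have h1 := hL₂ (value gen (w.take i)) (value gen (w.take j))
      rw [hw.wordLength_take hgen hij hj] at h1
      have h2 := Nat.mul_le_mul_right (Γ.dist (value gen (w.take i)) (value gen (w.take j)))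
        (show L₂ ≤ L₁ + L₂ by omega)
      omega
  obtain ⟨R, hR⟩ := hδ.exists_tracksGeodesics hΓ (L₁ + L₂)
  obtain ⟨R', hR'⟩ := hδ.exists_dist_interval_le hΓ (L₁ + L₂)
  set D := R' + δ + R + L₁
  refine ⟨L₂ * D + L₂ * D, fun w w' hw hw' hd i hi => ?_⟩
  obtain ⟨a, ha, hia⟩ := hR' _ _ (quasi w hw) i hi
  simp only [List.take_zero, value_nil, List.take_length] at ha
  obtain ⟨b, hb, hab⟩ := hδ _ _ (value gen w') a ha
  have hbj : ∃ j ≤ w'.length, Γ.dist b (value gen (w'.take j)) ≤ R + L₁ := by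
    rcases hb with hb | hb
    · obtain ⟨j, hj, hbj⟩ := hR _ _ (quasi w' hw') b
        (by simpa only [List.take_zero, value_nil, List.take_length] using hb)
      exact ⟨j, hj, by dsimp only at hbj; omega⟩
    · refine ⟨w'.length, le_rfl, ?_⟩
      rw [SimpleGraph.mem_interval] at hb
      have h1 := (hL₁ (value gen w) (value gen w')).trans (Nat.mul_le_mul_left L₁ hd)
      rw [Γ.dist_comm (u := value gen w)] at h1
      rw [List.take_length, Γ.dist_comm]
      omega
  obtain ⟨j, hj, hbj⟩ := hbj
  have h1 : Γ.dist (value gen (w.take i)) (value gen (w'.take j)) ≤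
    Γ.dist (value gen (w.take i)) a + Γ.dist a (value gen (w'.take j)) := hΓ.dist_triangle
  have h2 : Γ.dist a (value gen (w'.take j)) ≤ Γ.dist a b + Γ.dist b (value gen (w'.take j)) :=
    hΓ.dist_triangle
  have h3 := (hL₂ (value gen (w.take i)) (value gen (w'.take j))).trans
    (Nat.mul_le_mul_left L₂ (show _ ≤ D by omega))
  -- the time parameter of a geodesic word is the distance from `1`, so `i` and `j` are close
  have h4 := hw.wordLength_take hgen (Nat.zero_le i) hi
  have h5 := hw'.wordLength_take hgen (Nat.zero_le j) hj
  simp only [List.take_zero, value_nil, inv_one, one_mul, Nat.sub_zero] at h4 h5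
  have h6 := hgen.wordLength_mul_le (value gen (w.take i))
    ((value gen (w.take i))⁻¹ * value gen (w'.take j))
  have h7 := hgen.wordLength_mul_le (value gen (w'.take j))
    ((value gen (w'.take j))⁻¹ * value gen (w.take i))
  rw [mul_inv_cancel_left] at h6 h7
  rw [hgen.wordLength_inv_mul_comm] at h7
  have h8 := wordLength_value_take_le hgen w' j i
  have h9 := hgen.wordLength_inv_mul_le (value gen (w.take i)) (value gen (w'.take j))
    (value gen (w'.take i))
  omega

end GeneratedGroup

/-! ### Cone types -/

namespace GeneratedGroup

variable {G : Type*} [Group G] {k : ℕ} {gen : Fin k → G}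

/-- The `r`-type of `g`: the elements `h` of length at most `r` such that `g * h` is closer to `1`
than `g` is. -/
def shorteningSet (gen : Fin k → G) (r : ℕ) (g : G) : Set G :=
  {h | wordLength gen h ≤ r ∧ wordLength gen (g * h) < wordLength gen g}

/-- Geodesic words of the same `r`-type, for `r` large, have the same geodesic continuations: a
shortcut for a continuation of `w'` fellow-travels with it, hence passes near the end of `w'`
through an element of the `r`-type, and so gives a shortcut for the same continuation of `w`. -/
lemma isGeodesicWord_append_of_shorteningSet_eq (hgen : IsGeneratingSet gen) {K : ℕ}
    (hK : ∀ w w' : List (Fin k), IsGeodesicWord gen w → IsGeodesicWord gen w' →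
      wordLength gen ((value gen w)⁻¹ * value gen w') ≤ 1 → ∀ i ≤ w.length,
        wordLength gen ((value gen (w.take i))⁻¹ * value gen (w'.take i)) ≤ K)
    {w w' : List (Fin k)} (hw' : IsGeodesicWord gen w')
    (h : shorteningSet gen (K + 1) (value gen w) = shorteningSet gen (K + 1) (value gen w'))
    (u : List (Fin k)) (hwu : IsGeodesicWord gen (w ++ u)) : IsGeodesicWord gen (w' ++ u) := by
  have hone : ∀ a, wordLength gen (gen a) ≤ 1 := fun a => by
    simpa using wordLength_value_le (gen := gen) [a]
  have hw : IsGeodesicWord gen w := (isGeodesicWord_append hgen hwu).1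
  rcases List.eq_nil_or_concat w' with rfl | ⟨w₀, b, rfl⟩
  · -- the type of `1` is empty, and the type of a nontrivial element is not
    rcases List.eq_nil_or_concat w with rfl | ⟨w₁, c, rfl⟩
    · exact hwu
    · exfalso
      have hmem : (gen c)⁻¹ ∈ shorteningSet gen (K + 1) (value gen (w₁.concat c)) := by
        refine ⟨?_, ?_⟩
        · rw [hgen.wordLength_inv]
          exact (hone c).trans (by omega)
        · rw [← hw]
          have := wordLength_value_le (gen := gen) w₁
          simp
          omega
      rw [h] at hmem
      simpa [wordLength_one] using hmem.2
  induction u using List.reverseRecOn with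
  | nil => simpa using hw'
  | append_singleton u a ih =>
    have hwu' : IsGeodesicWord gen (w ++ u) := by
      rw [← List.append_assoc] at hwu
      exact (isGeodesicWord_append hgen hwu).1
    have hu := ih hwu'
    by_contra hcon
    set w' := w₀.concat b with hw'_def
    have hlen' : w'.length = w₀.length + 1 := by simp [hw'_def]
    obtain ⟨v, hv, hvg⟩ := hgen.exists_isGeodesicWord (value gen (w' ++ (u ++ [a])))
    have hvlen : v.length ≤ w'.length + u.length := by
      have h1 := wordLength_value_le (gen := gen) (w' ++ (u ++ [a]))
      rw [IsGeodesicWord] at hcon hvg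
      rw [← hv] at h1 hcon
      simp only [List.length_append, List.length_singleton] at h1 hcon
      omega
    -- compare the two geodesics one step before the end of `w'`
    have htake : (w' ++ u).take w₀.length = w₀ := by simp [hw'_def]
    have hfellow := hK (w' ++ u) v hu hvg (by
      rw [hv, ← List.append_assoc, value_append (w' ++ u), inv_mul_cancel_left]
      simpa using hone a) w₀.length (by simp [hlen']; omega)
    rw [htake] at hfellow
    set x := value gen (v.take w₀.length)
    have hval' : value gen w' = value gen w₀ * gen b := by simp [hw'_def]
    have hmem : (value gen w')⁻¹ * x ∈ shorteningSet gen (K + 1) (value gen w') := by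
      refine ⟨?_, ?_⟩
      · have h1 := hgen.wordLength_inv_mul_le (value gen w') (value gen w₀) x
        have h2 : wordLength gen ((value gen w')⁻¹ * value gen w₀) ≤ 1 := by
          rw [hgen.wordLength_inv_mul_comm, hval', inv_mul_cancel_left]
          exact hone b
        omega
      · rw [mul_inv_cancel_left, ← hw']
        have h1 : wordLength gen x ≤ _ := wordLength_value_le (v.take w₀.length)
        have h2 := List.length_take_le w₀.length v
        omega
    rw [← h] at hmem
    have hlt := hmem.2
    rw [← hw] at hlt
    have hsplit : value gen (w ++ (u ++ [a])) =
        (value gen w * ((value gen w')⁻¹ * x)) * value gen (v.drop w₀.length) := by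
      have h1 : x * value gen (v.drop w₀.length) = value gen v := by
        rw [← value_append, List.take_append_drop]
      rw [mul_assoc, mul_assoc, h1, hv, value_append, value_append w', inv_mul_cancel_left]
    have hub := hgen.wordLength_mul_le (value gen w * ((value gen w')⁻¹ * x))
      (value gen (v.drop w₀.length))
    rw [← hsplit, ← hwu] at hub
    have hdrop := wordLength_value_le (gen := gen) (v.drop w₀.length)
    rw [List.length_drop] at hdrop
    simp only [List.length_append, List.length_singleton] at hub
    omega

end GeneratedGroup

/-! ### Regularity of the language of pairs of geodesics -/

namespace TwoTape

lemma pad_eq_zip {α : Type*} : ∀ {w w' : List α}, w.length = w'.length →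
    pad w w' = List.zip (w.map some) (w'.map some)
  | [], [], _ => rfl
  | a :: w, b :: w', h => by
    have := pad_eq_zip (w := w) (w' := w') (by simpa using h)
    simpa [pad] using this

lemma pad_append {α : Type*} {w w' u u' : List α} (h : w.length = w'.length)
    (h' : u.length = u'.length) : pad (w ++ u) (w' ++ u') = pad w w' ++ pad u u' := by
  rw [pad_eq_zip (by simp [h, h']), pad_eq_zip h, pad_eq_zip h', List.map_append, List.map_append,
    List.zip_append (by simpa using h)]

lemma pad_inj {α : Type*} {w w' u u' : List α} (h : w.length = w'.length)
    (h' : u.length = u'.length) (he : pad w w' = pad u u') : w = u ∧ w' = u' := by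
  rw [pad_eq_zip h, pad_eq_zip h'] at he
  have h1 := congrArg List.unzip he
  rw [List.unzip_zip (by simpa using h), List.unzip_zip (by simpa using h'), Prod.mk.injEq] at h1
  exact ⟨List.map_injective_iff.mpr (Option.some_injective _) h1.1,
    List.map_injective_iff.mpr (Option.some_injective _) h1.2⟩

lemma length_pad {α : Type*} {w w' : List α} (h : w.length = w'.length) :
    (pad w w').length = w.length := by
  rw [pad_eq_zip h]; simp [h]

/-- A prefix of a padded pair of words of equal length is a padded pair of prefixes. -/
lemma exists_of_append_eq_pad {α : Type*} {x y : List (Letter α)} {W W' : List α}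
    (hW : W.length = W'.length) (h : x ++ y = pad W W') :
    ∃ w w' u u', w.length = w'.length ∧ u.length = u'.length ∧ W = w ++ u ∧ W' = w' ++ u' ∧
      x = pad w w' ∧ y = pad u u' := by
  have hs := pad_append (w := W.take x.length) (w' := W'.take x.length) (u := W.drop x.length)
    (u' := W'.drop x.length) (by simp [hW]) (by simp [hW])
  rw [List.take_append_drop, List.take_append_drop, ← h] at hs
  have hl : x.length ≤ W.length := by
    rw [← length_pad hW, ← h]; simp
  obtain ⟨h1, h2⟩ := List.append_inj hs
    (by rw [length_pad (by simp [hW]), List.length_take, min_eq_left hl])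
  exact ⟨_, _, _, _, by simp [hW], by simp [hW], (List.take_append_drop _ _).symm,
    (List.take_append_drop _ _).symm, h1, h2⟩

end TwoTape

namespace GeneratedGroup

open TwoTape

variable {G : Type*} [Group G] {k : ℕ} {gen : Fin k → G}

/-- The pairs of geodesic words with the same value. -/
def GeodesicPair (gen : Fin k → G) (w w' : List (Fin k)) : Prop :=
  IsGeodesicWord gen w ∧ IsGeodesicWord gen w' ∧ value gen w = value gen w'

lemma GeodesicPair.length_eq {w w' : List (Fin k)} (h : GeodesicPair gen w w') :
    w.length = w'.length := by
  have h1 : w.length = _ := h.1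
  have h2 : w'.length = _ := h.2.1
  rw [h1, h2, h.2.2]

lemma IsGeodesicWord.of_value_eq {w w' : List (Fin k)} (h : IsGeodesicWord gen w)
    (hl : w.length = w'.length) (hv : value gen w = value gen w') : IsGeodesicWord gen w' := by
  rw [IsGeodesicWord, ← hl, ← hv]; exact h

lemma pad_mem_relLanguage_iff {w w' : List (Fin k)} (hl : w.length = w'.length) :
    pad w w' ∈ relLanguage (GeodesicPair gen) ↔ GeodesicPair gen w w' := by
  constructor
  · rintro ⟨u, u', hu, he⟩
    obtain ⟨rfl, rfl⟩ := pad_inj hu.length_eq hl he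
    exact hu
  · exact fun h => ⟨w, w', h, rfl⟩

/-- The finite data that determine which continuations of a pair `(w, w')` of geodesic words are
pairs of geodesics: the word difference and the `r`-type of the value of the first word. -/
def pairState (gen : Fin k → G) (r : ℕ) (w w' : List (Fin k)) : G × Set G :=
  ((value gen w)⁻¹ * value gen w', shorteningSet gen r (value gen w))

/-- The language of pairs of geodesics is regular: the word difference stays bounded by fellow
travelling, and together with the type of the first word it determines the left quotient. -/
theorem isRegular_relLanguage_geodesicPair (hG : IsWordHyperbolic G)
    (hgen : IsGeneratingSet gen) : (relLanguage (GeodesicPair gen)).IsRegular := by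
  obtain ⟨K, hK⟩ := exists_fellowTravel hG hgen
  set L := relLanguage (GeodesicPair gen)
  have hprefix : ∀ x y, x ++ y ∈ L → ∃ w w' u u', w.length = w'.length ∧ u.length = u'.length ∧
      GeodesicPair gen (w ++ u) (w' ++ u') ∧ x = pad w w' ∧ y = pad u u' := by
    rintro x y ⟨W, W', hW, he⟩
    obtain ⟨w, w', u, u', hl, hl', rfl, rfl, hx, hy⟩ :=
      exists_of_append_eq_pad hW.length_eq he.symm
    exact ⟨w, w', u, u', hl, hl', hW, hx, hy⟩
  have hquot : ∀ w w' v v' : List (Fin k), w.length = w'.length → v.length = v'.length →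
      IsGeodesicWord gen v → pairState gen (K + 1) w w' = pairState gen (K + 1) v v' →
      L.leftQuotient (pad w w') ≤ L.leftQuotient (pad v v') := by
    intro w w' v v' hl hl' hv hst y hy
    obtain ⟨w₁, w₁', u, u', h1, h2, h3, h4, rfl⟩ := hprefix _ _ hy
    obtain ⟨rfl, rfl⟩ := pad_inj hl h1 h4
    obtain ⟨hd, ht⟩ := Prod.mk.injEq .. ▸ hst
    have hg := isGeodesicWord_append_of_shorteningSet_eq hgen hK hv ht u h3.1
    have hval : value gen (v ++ u) = value gen (v' ++ u') := by
      have h5 := h3.2.2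
      rw [value_append, value_append, ← eq_inv_mul_iff_mul_eq, ← mul_assoc, hd] at h5
      rw [value_append, value_append, h5, mul_assoc, mul_inv_cancel_left]
    have hmem : pad v v' ++ pad u u' ∈ L := by
      rw [← pad_append hl' h2, pad_mem_relLanguage_iff (by simp [hl', h2])]
      exact ⟨hg, hg.of_value_eq (by simp [hl', h2]) hval, hval⟩
    exact hmem
  have hfin := hgen.finite_setOf_wordLength_le K
  have hfin' := (hgen.finite_setOf_wordLength_le (K + 1)).finite_subsets
  refine Language.IsRegular.of_finite_range_leftQuotient ?_
  -- every nonempty left quotient is recovered from the word difference and the type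
  let Q : G × Set G → Language (Letter (Fin k)) := fun d =>
    {y | ∃ w w', w.length = w'.length ∧ IsGeodesicWord gen w ∧ pairState gen (K + 1) w w' = d ∧
      y ∈ L.leftQuotient (pad w w')}
  refine (((hfin.prod hfin').image Q).insert 0).subset ?_
  rintro _ ⟨x, rfl⟩
  rcases Set.eq_empty_or_nonempty (L.leftQuotient x : Set (List (Letter (Fin k))))
    with he | ⟨y, hy⟩
  · exact Or.inl he
  right
  obtain ⟨w, w', u, u', hl, hl', hp, rfl, rfl⟩ := hprefix _ _ hy
  have hw := (isGeodesicWord_append hgen hp.1).1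
  refine ⟨pairState gen (K + 1) w w', ⟨?_, fun h hh => hh.1⟩, ?_⟩
  · have := hK _ _ hp.1 hp.2.1 (by rw [hp.2.2]; simp [wordLength_one]) w.length (by simp)
    rw [List.take_left, hl, List.take_left] at this
    exact this
  · refine le_antisymm ?_ ?_
    · rintro z ⟨v, v', hlv, hv, hst, hz⟩
      exact hquot v v' w w' hlv hl hw hst hz
    · intro z hz
      exact ⟨w, w', hl, hw, rfl, hz⟩

end GeneratedGroup

/-! ### Walks in the Cayley graph and words -/

namespace GeneratedGroup

variable {G : Type*} [Group G] {k : ℕ} {gen : Fin k → G}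

namespace IsGeneratingSet

lemma exists_mul_eq_of_adj (hgen : IsGeneratingSet gen) {x y : G}
    (h : (SimpleGraph.mulCayley (Set.range gen)).Adj x y) : ∃ i, x * gen i = y := by
  obtain ⟨-, ⟨i, hi⟩ | ⟨i, hi⟩⟩ := (SimpleGraph.mulCayley_adj _ _ _).mp h
  · exact ⟨i, by rw [hi, mul_inv_cancel_left]⟩
  · obtain ⟨j, hj⟩ := hgen.inv_mem i
    exact ⟨j, by simp [hj, hi]⟩

/-- The word read along a walk in the Cayley graph. -/
noncomputable def walkWord (hgen : IsGeneratingSet gen) :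
    ∀ {x y : G}, (SimpleGraph.mulCayley (Set.range gen)).Walk x y → List (Fin k)
  | _, _, .nil => []
  | _, _, .cons h p => (hgen.exists_mul_eq_of_adj h).choose :: hgen.walkWord p

lemma length_walkWord (hgen : IsGeneratingSet gen) {x y : G}
    (p : (SimpleGraph.mulCayley (Set.range gen)).Walk x y) :
    (hgen.walkWord p).length = p.length := by
  induction p with
  | nil => rfl
  | cons h p ih => simp [walkWord, ih]

lemma mul_value_walkWord (hgen : IsGeneratingSet gen) {x y : G}
    (p : (SimpleGraph.mulCayley (Set.range gen)).Walk x y) :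
    x * value gen (hgen.walkWord p) = y := by
  induction p with
  | nil => simp [walkWord]
  | cons h p ih =>
    rw [walkWord, value_cons, ← mul_assoc, (hgen.exists_mul_eq_of_adj h).choose_spec, ih]

lemma walkWord_injective (hgen : IsGeneratingSet gen) {x y : G}
    (p q : (SimpleGraph.mulCayley (Set.range gen)).Walk x y)
    (h : hgen.walkWord p = hgen.walkWord q) : p = q := by
  induction p with
  | nil =>
    cases q with
    | nil => rfl
    | cons h' q => simp [walkWord] at h
  | @cons x z y hp p ih =>
    cases q with
    | nil => simp [walkWord] at h
    | @cons _ z' _ hq q =>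
      rw [walkWord, walkWord, List.cons.injEq] at h
      have h1 := (hgen.exists_mul_eq_of_adj hp).choose_spec
      have h2 := (hgen.exists_mul_eq_of_adj hq).choose_spec
      obtain rfl : z = z' := by rw [← h1, ← h2, h.1]
      rw [ih q h.2]

lemma exists_walkWord_eq (hgen : IsGeneratingSet gen) (w : List (Fin k)) :
    ∀ x y : G, IsGeodesicWord gen w → x * value gen w = y →
      ∃ p : (SimpleGraph.mulCayley (Set.range gen)).Walk x y, hgen.walkWord p = w := by
  induction w with
  | nil =>
    rintro x y - h
    obtain rfl : x = y := by simpa using h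
    exact ⟨.nil, rfl⟩
  | cons a w ih =>
    intro x y hw h
    have hw' := (isGeodesicWord_append (w := [a]) hgen hw).2
    obtain ⟨p, hp⟩ := ih (x * gen a) y hw' (by rw [← h, value_cons, mul_assoc])
    -- a trivial letter could be deleted from the geodesic word
    have ha : gen a ≠ 1 := by
      intro ha
      rw [IsGeodesicWord, value_cons, ha, one_mul, List.length_cons] at hw
      have := wordLength_value_le (gen := gen) w
      omega
    have hadj : (SimpleGraph.mulCayley (Set.range gen)).Adj x (x * gen a) := by
      rw [SimpleGraph.mulCayley_adj]
      exact ⟨by simpa using ha, Or.inl (by simp)⟩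
    refine ⟨.cons hadj p, ?_⟩
    have h1 := (hgen.exists_mul_eq_of_adj hadj).choose_spec
    rw [walkWord, hp, hgen.injective (mul_left_cancel h1)]

lemma dist_one_mulCayley (hgen : IsGeneratingSet gen) (g : G) :
    (SimpleGraph.mulCayley (Set.range gen)).dist 1 g = wordLength gen g := by
  obtain ⟨w, hw, hl⟩ := hgen.exists_isGeodesicWord g
  obtain ⟨p, rfl⟩ := hgen.exists_walkWord_eq w 1 g hl (by simpa using hw)
  refine le_antisymm ?_ ?_
  · have h : wordLength gen g = p.length := by rw [← hgen.length_walkWord, hl, hw]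
    exact h ▸ SimpleGraph.dist_le p
  · obtain ⟨q, hq⟩ := p.reachable.exists_walk_length_eq_dist
    have hv := hgen.mul_value_walkWord q
    rw [one_mul] at hv
    rw [← hq, ← hgen.length_walkWord q]
    conv_lhs => rw [← hv]
    exact wordLength_value_le _

lemma pascal_eq_card (hgen : IsGeneratingSet gen) (g : G) :
    pascal gen g = (Nat.card {w // IsGeodesicWord gen w ∧ value gen w = g} : ℤ) := by
  rw [pascal, Nat.cast_inj]
  have hval : ∀ p : (SimpleGraph.mulCayley (Set.range gen)).Walk 1 g,
      value gen (hgen.walkWord p) = g := fun p => by simpa using hgen.mul_value_walkWord p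
  have hiff : ∀ p : (SimpleGraph.mulCayley (Set.range gen)).Walk 1 g,
      p.IsGeodesic ↔ IsGeodesicWord gen (hgen.walkWord p) := fun p => by
    rw [SimpleGraph.Walk.IsGeodesic, IsGeodesicWord, hval, hgen.length_walkWord,
      hgen.dist_one_mulCayley]
  refine Nat.card_congr (Equiv.ofBijective
    (fun p => ⟨hgen.walkWord p.1, (hiff p.1).mp p.2, hval p.1⟩) ⟨?_, ?_⟩)
  · intro p q hpq
    exact Subtype.ext (hgen.walkWord_injective _ _ (congrArg Subtype.val hpq))
  · rintro ⟨w, hw, hv⟩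
    obtain ⟨p, rfl⟩ := hgen.exists_walkWord_eq w 1 g hw (by simpa using hv)
    exact ⟨⟨p, (hiff p).mpr hw⟩, rfl⟩

end IsGeneratingSet

end GeneratedGroup

/-! ### Counting accepted words with transition matrices -/

namespace TwoTape

variable {α σ : Type*} [Finite α] (F : DFA (Letter α) σ)

/-- The second tapes of full length for which `F`, started in state `s` with first tape `w`, ends
in an accept state. -/
def AcceptedSecondTape (w : List α) (s : σ) : Type _ :=
  {x : List (Option α) //
    x.length = w.length ∧ F.evalFrom s (List.zip (w.map some) x) ∈ F.accept}

instance (w : List α) (s : σ) : Finite (AcceptedSecondTape F w s) :=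
  ((List.finite_length_eq (Option α) w.length).subset fun _ hx => hx.1).to_subtype

/-- Accepted second tapes are sorted by their first letter. -/
noncomputable def acceptedSecondTapeConsEquiv (a : α) (w : List α) (s : σ) :
    AcceptedSecondTape F (a :: w) s ≃
      Σ a' : Option α, AcceptedSecondTape F w (F.step s (some a, a')) where
  toFun
    | ⟨[], h⟩ => absurd h.1 (by simp)
    | ⟨a' :: x, h⟩ => ⟨a', x, by simpa using h.1, h.2⟩
  invFun x := ⟨x.1 :: x.2.1, by simpa using x.2.2.1, x.2.2.2⟩
  left_inv
    | ⟨[], h⟩ => absurd h.1 (by simp)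
    | ⟨a' :: x, h⟩ => rfl
  right_inv _ := rfl

variable [Fintype σ] [DecidableEq σ]

/-- Products of transition matrices count accepted second tapes. -/
lemma prod_transitionMatrix_mulVec (w : List α) (s : σ) :
    ((w.map (transitionMatrix F)).prod *ᵥ acceptVector F) s =
      (Nat.card (AcceptedSecondTape F w s) : ℤ) := by
  classical
  induction w generalizing s with
  | nil =>
    rw [List.map_nil, List.prod_nil, Matrix.one_mulVec, acceptVector, Set.indicator_apply]
    split_ifs with h
    · have : Nat.card (AcceptedSecondTape F [] s) = 1 := by
        rw [Nat.card_eq_one_iff_unique]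
        refine ⟨⟨fun x y => Subtype.ext ?_⟩, ⟨[], rfl, h⟩⟩
        rw [List.length_eq_zero_iff.mp x.2.1, List.length_eq_zero_iff.mp y.2.1]
      simp [this]
    · have : IsEmpty (AcceptedSecondTape F [] s) := ⟨fun x => h (by simpa using x.2.2)⟩
      simp
  | cons a w ih =>
    have := Fintype.ofFinite α
    rw [List.map_cons, List.prod_cons, ← Matrix.mulVec_mulVec, Matrix.mulVec, dotProduct,
      Nat.card_congr (acceptedSecondTapeConsEquiv F a w s), Nat.card_sigma, Nat.cast_sum]
    simp only [ih, transitionMatrix, Matrix.of_apply, Nat.card_eq_fintype_card,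
      Fintype.card_subtype]
    -- group the letters of the second tape by the state to which they lead
    rw [← Finset.sum_fiberwise Finset.univ (fun a' => F.step s (some a, a'))]
    refine Finset.sum_congr rfl fun t _ => ?_
    rw [Finset.sum_congr rfl (g := fun _ => (Nat.card (AcceptedSecondTape F w t) : ℤ))]
    · simp
    · intro a' ha'
      rw [(Finset.mem_filter.mp ha').2]

lemma startVector_vecMul_dotProduct (w : List α) :
    (startVector F ᵥ* (w.map (transitionMatrix F)).prod) ⬝ᵥ acceptVector F =
      (Nat.card (AcceptedSecondTape F w F.start) : ℤ) := by
  rw [← Matrix.dotProduct_mulVec, startVector, single_one_dotProduct,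
    prod_transitionMatrix_mulVec]

end TwoTape

namespace GeneratedGroup

open TwoTape

variable {G : Type*} [Group G] {k : ℕ} {gen : Fin k → G}

lemma card_acceptedSecondTape {σ : Type*} {F : DFA (Letter (Fin k)) σ}
    (hF : F.accepts = relLanguage (GeodesicPair gen)) {w : List (Fin k)}
    (hw : IsGeodesicWord gen w) :
    Nat.card (AcceptedSecondTape F w F.start) =
      Nat.card {w' // IsGeodesicWord gen w' ∧ value gen w' = value gen w} := by
  have hacc : ∀ x, F.evalFrom F.start x ∈ F.accept ↔ x ∈ relLanguage (GeodesicPair gen) := by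
    intro x; rw [← hF]; rfl
  have hpair : ∀ {w'}, IsGeodesicWord gen w' ∧ value gen w' = value gen w →
      GeodesicPair gen w w' := fun h => ⟨hw, h.1, h.2.symm⟩
  symm
  refine Nat.card_congr (Equiv.ofBijective (fun w' => ⟨w'.1.map some,
    by simp [(hpair w'.2).length_eq], ?_⟩) ⟨?_, ?_⟩)
  · rw [hacc, ← pad_eq_zip (hpair w'.2).length_eq]
    exact ⟨_, _, hpair w'.2, rfl⟩
  · intro w₁ w₂ h
    exact Subtype.ext (List.map_injective_iff.mpr (Option.some_injective _)
      (congrArg Subtype.val h))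
  · rintro ⟨x, hx, hmem⟩
    obtain ⟨u, u', hu, he⟩ := (hacc _).mp hmem
    rw [pad_eq_zip hu.length_eq] at he
    have h1 := congrArg List.unzip he
    rw [List.unzip_zip (by simpa using hu.length_eq), List.unzip_zip (by simp [hx]),
      Prod.mk.injEq] at h1
    obtain rfl : u = w := List.map_injective_iff.mpr (Option.some_injective _) h1.1
    exact ⟨⟨u', hu.2.1, hu.2.2.symm⟩, Subtype.ext h1.2⟩

end GeneratedGroup

theorem mainTheorem1 {G : Type*} [Group G] (hG : IsWordHyperbolic G)
    {k : ℕ} (gen : Fin k → G) (hgen : GeneratedGroup.IsGeneratingSet gen) :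
    ∃ (m : ℕ) (M : Fin k → Matrix (Fin m) (Fin m) ℤ) (u v : Fin m → ℤ),
      (∀ (g : G) (w : List (Fin k)),
        GeneratedGroup.IsGeodesicWord gen w → GeneratedGroup.value gen w = g →
          GeneratedGroup.pascal gen g = (u ᵥ* (w.map M).prod) ⬝ᵥ v) ∧
      ∃ F : DFA (TwoTape.Letter (Fin k)) (Fin m),
        F.accepts = TwoTape.relLanguage (fun w w' =>
          GeneratedGroup.IsGeodesicWord gen w ∧ GeneratedGroup.IsGeodesicWord gen w' ∧
            GeneratedGroup.value gen w = GeneratedGroup.value gen w') ∧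
        (∀ i, M i = TwoTape.transitionMatrix F i) ∧
        u = TwoTape.startVector F ∧ v = TwoTape.acceptVector F := by
  obtain ⟨σ, _, F₀, hF₀⟩ := GeneratedGroup.isRegular_relLanguage_geodesicPair hG hgen
  set F : DFA (TwoTape.Letter (Fin k)) (Fin (Fintype.card σ)) :=
    F₀.reindex (Fintype.equivFin σ)
  have hF : F.accepts = TwoTape.relLanguage (GeneratedGroup.GeodesicPair gen) :=
    (DFA.accepts_reindex F₀ _).trans hF₀
  refine ⟨_, TwoTape.transitionMatrix F, TwoTape.startVector F, TwoTape.acceptVector F,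
    ?_, F, hF, fun _ => rfl, rfl, rfl⟩
  rintro _ w hw rfl
  rw [TwoTape.startVector_vecMul_dotProduct, hgen.pascal_eq_card,
    GeneratedGroup.card_acceptedSecondTape hF hw]
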